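/- Let $\mathbb K$ be a field and $d\ge 0$ an integer; index the rows and columns of matrices in $\mathrm{Mat}_{d+1}(\mathbb K)$ by $0,1,\dots,d$. **TH systems.** Let $V$ be a $\mathbb K$-vector space of dimension $d+1$. An element $A\in\mathrm{End}(V)$ is multiplicity-free if $V$ is spanned by the eigenspaces of $A$ and each of these has dimension one; the primitive idempotent of $A$ corresponding to an eigenvalue $\theta$ is the element of $\mathrm{End}(V)$ that is the identity on the $\theta$-eigenspace and $0$ on all the other eigenspaces. A TH system on $V$ of diameter $d$ is a sequence $\Phi=(A;\{E_i\}_{i=0}^d;A^*;\{E^*_i\}_{i=0}^d)$ of elements of $\mathrm{End}(V)$ such that $A,A^*$ are multiplicity-free, $\{E_i\}$ (resp. $\{E_i^*\}$) is an ordering of the primitive idempotents of $A$ (resp. $A^*$), and both $E_iA^*E_j$ and $E_i^*AE_j^*$ are zero if $i-j>1$ and nonzero if $i-j=1$. Let $\theta_i$ (resp. $\theta_i^*$) be the eigenvalue of $A$ (resp. $A^*$) corresponding to $E_i$ (resp. $E_i^*$); $\{\theta_i\}$ and $\{\theta^*_i\}$ are the eigenvalue and dual eigenvalue sequences of $\Phi$.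 TH systems $\Phi$ on $V$ and $\Psi$ on $W$ are isomorphic if some $\mathbb K$-algebra isomorphism $\mathrm{End}(V)\to\mathrm{End}(W)$ carries $\Phi$ to $\Psi$ entry by entry. For $0\le i\le d$ let $U_i=(E_0^*V+\cdots+E_i^*V)\cap(E_0V+\cdots+E_{d-i}V)$. For $1\le i\le d$ the space $U_i$ has dimension one and is invariant under $(A-\theta_{d-i+1}I)(A^*-\theta_i^*I)$; let $\varphi_i$ be the corresponding eigenvalue. The west-south normalized transition matrix of $\Phi$ is the matrix $\mathcal P\in\mathrm{Mat}_{d+1}(\mathbb K)$ with entries $$\mathcal P_{ij}=\sum_{h=0}^d\frac{(\theta_i-\theta_d)(\theta_i-\theta_{d-1})\cdots(\theta_i-\theta_{d-h+1})\,(\theta_j^*-\theta_0^*)(\theta_j^*-\theta_1^*)\cdots(\theta_j^*-\theta_{h-1}^*)}{\varphi_1\varphi_2\cdots\varphi_h}.$$ **Vandermonde systems.** A sequence of polynomials $\{f_i\}_{i=0}^d$ in $\mathbb K[\lambda]$ is graded if $f_0=1$ and $\deg f_i=i$ for all $i$. A west Vandermonde system $(X,\{\theta_i\}_{i=0}^d)$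 consists of $X\in\mathrm{Mat}_{d+1}(\mathbb K)$ and mutually distinct $\theta_i\in\mathbb K$ such that $X_{i0}\ne0$ for all $i$ and, for some graded sequence $\{f_i\}$, $X_{ij}=X_{i0}f_j(\theta_i)$ for all $i,j$. A south Vandermonde system is a pair $(X,\{\theta_i^*\}_{i=0}^d)$ such that $(X',\{\theta_i^*\})$ is a west Vandermonde system, where $X'$ is obtained by rotating $X$ clockwise by $90$ degrees. A normalized west-south Vandermonde system in $\mathrm{Mat}_{d+1}(\mathbb K)$ is a sequence $(X,\{\theta_i\},\{\theta_i^*\})$ such that $(X,\{\theta_i\})$ is a west Vandermonde system, $(X,\{\theta_i^*\})$ is a south Vandermonde system, and $X_{i0}=X_{di}=1$ for $0\le i\le d$. **The maps.** The map $\rho$ sends the isomorphism class of a TH system $\Phi$ over $\mathbb K$ of diameter $d$ to $(\mathcal P,\{\theta_i\},\{\theta_i^*\})$, formed from $\Phi$ as above. The map $\chi$ sends a normalized west-south Vandermonde system $(X,\{\theta_i\},\{\theta_i^*\})$ to the isomorphism class of the following $\Phi=(A;\{E_i\};A^*;\{E_i^*\})$: on a vector space $V$ of dimension $d+1$ choose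 bases $\{u_i\}$, $\{v_i\}$ with $v_j=\sum_iX_{ij}u_i$; let $Au_i=\theta_iu_i$ and $A^*v_i=\theta_i^*v_i$ for all $i$; let $E_i$ (resp. $E_i^*$) be the primitive idempotent of $A$ (resp. $A^*$) corresponding to $\theta_i$ (resp. $\theta_i^*$). **Theorem.** The maps $\rho$ and $\chi$ are well defined: $\rho$ takes values in the set of normalized west-south Vandermonde systems and does not depend on the representative $\Phi$; bases as in the definition of $\chi$ exist on every $V$, the sequence $\Phi$ constructed from them is a TH system, and its isomorphism class does not depend on $V$ or on the bases. Moreover $\rho$ and $\chi$ are inverses of each other, and each of them is a bijection between the set of isomorphism classes of TH systems over $\mathbb K$ of diameter $d$ and the set of normalized west-south Vandermonde systems in $\mathrm{Mat}_{d+1}(\mathbb K)$. -/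

import Mathlib

universe u v w w'

namespace THVand

open Polynomial

section Systems

variable {K : Type u} [Field K]

/-- `A` is multiplicity-free: `V` is spanned by the eigenspaces of `A`, and each eigenspace of `A`
has dimension one. -/
def IsMultiplicityFree {V : Type w} [AddCommGroup V] [Module K V] (A : Module.End K V) : Prop :=
  (⨆ θ : K, A.eigenspace θ) = ⊤ ∧ ∀ θ : K, A.HasEigenvalue θ → Module.finrank K (A.eigenspace θ) = 1

/-- `E` is the primitive idempotent of `A` corresponding to the eigenvalue `θ`: it is the identity
on the eigenspace for `θ` and zero on all the other eigenspaces. -/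
structure IsPrimitiveIdempotent {V : Type w} [AddCommGroup V] [Module K V]
    (A : Module.End K V) (θ : K) (E : Module.End K V) : Prop where
  hasEigenvalue : A.HasEigenvalue θ
  apply_self : ∀ x ∈ A.eigenspace θ, E x = x
  apply_other : ∀ μ : K, μ ≠ θ → ∀ x ∈ A.eigenspace μ, E x = 0

/-- `E 0, …, E d` is an ordering of the primitive idempotents of `A`: each primitive idempotent
occurs exactly once. -/
structure IsPrimitiveIdempotentOrdering {V : Type w} [AddCommGroup V] [Module K V] {d : ℕ}
    (A : Module.End K V) (E : Fin (d + 1) → Module.End K V) : Prop where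
  isPrimitive : ∀ i, ∃ θ, IsPrimitiveIdempotent A θ (E i)
  injective : Function.Injective E
  exhaustive : ∀ θ F, IsPrimitiveIdempotent A θ F → ∃ i, E i = F

/-- A thin Hessenberg system `(A; E 0, …, E d; A*; E* 0, …, E* d)` of diameter `d` on a vector
space `V` of dimension `d + 1`. -/
structure THSystem (K : Type u) [Field K] (V : Type w) [AddCommGroup V] [Module K V] (d : ℕ) where
  finrank_eq : Module.finrank K V = d + 1
  A : Module.End K V
  E : Fin (d + 1) → Module.End K V
  Astar : Module.End K V
  Estar : Fin (d + 1) → Module.End K V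
  multiplicityFree : IsMultiplicityFree A
  multiplicityFree_star : IsMultiplicityFree Astar
  ordering : IsPrimitiveIdempotentOrdering A E
  ordering_star : IsPrimitiveIdempotentOrdering Astar Estar
  E_Astar_E_eq_zero : ∀ i j : Fin (d + 1), (j : ℕ) + 1 < i → E i * Astar * E j = 0
  E_Astar_E_ne_zero : ∀ i j : Fin (d + 1), (i : ℕ) = j + 1 → E i * Astar * E j ≠ 0
  Estar_A_Estar_eq_zero : ∀ i j : Fin (d + 1), (j : ℕ) + 1 < i → Estar i * A * Estar j = 0
  Estar_A_Estar_ne_zero : ∀ i j : Fin (d + 1), (i : ℕ) = j + 1 → Estar i * A * Estar j ≠ 0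

/-- Two TH systems are isomorphic when some `K`-algebra isomorphism `End V → End W` carries one to
the other, entry by entry. -/
def THSystem.Isomorphic {d : ℕ} {V : Type w} [AddCommGroup V] [Module K V]
    {W : Type w'} [AddCommGroup W] [Module K W]
    (Φ : THSystem K V d) (Ψ : THSystem K W d) : Prop :=
  ∃ γ : Module.End K V ≃ₐ[K] Module.End K W,
    γ Φ.A = Ψ.A ∧ γ Φ.Astar = Ψ.Astar ∧
      (∀ i, γ (Φ.E i) = Ψ.E i) ∧ ∀ i, γ (Φ.Estar i) = Ψ.Estar i

/-- `θ` is the eigenvalue sequence and `θs` the dual eigenvalue sequence of `Φ`. -/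
def THSystem.HasEigenvalueSequences {d : ℕ} {V : Type w} [AddCommGroup V] [Module K V]
    (Φ : THSystem K V d) (θ θs : Fin (d + 1) → K) : Prop :=
  (∀ i, IsPrimitiveIdempotent Φ.A (θ i) (Φ.E i)) ∧
    ∀ i, IsPrimitiveIdempotent Φ.Astar (θs i) (Φ.Estar i)

/-- The `Φ`-split decomposition:
`U i = (E* 0 V + ⋯ + E* i V) ∩ (E 0 V + ⋯ + E (d - i) V)`. -/
def THSystem.splitSpace {d : ℕ} {V : Type w} [AddCommGroup V] [Module K V]
    (Φ : THSystem K V d) (i : Fin (d + 1)) : Submodule K V :=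
  (⨆ j : Fin (d + 1), ⨆ _ : j ≤ i, LinearMap.range (Φ.Estar j)) ⊓
    ⨆ j : Fin (d + 1), ⨆ _ : j ≤ Fin.rev i, LinearMap.range (Φ.E j)

/-- `(θ, θs, φ)` is the parameter array of `Φ`: `θ`, `θs` are its eigenvalue and dual eigenvalue
sequences, and `φ` is its split sequence. The entry `φ k` (for `0 ≤ k < d`) stands for the scalar
`φ_{k+1}`: with `i = k + 1`, it is the eigenvalue of `(A - θ_{d-i+1} I)(A* - θ*_i I)` on the
one-dimensional space `U i`. -/
structure THSystem.HasParameterArray {d : ℕ} {V : Type w} [AddCommGroup V] [Module K V]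
    (Φ : THSystem K V d) (θ θs : Fin (d + 1) → K) (φ : Fin d → K) : Prop where
  eigenvalueSequences : Φ.HasEigenvalueSequences θ θs
  finrank_splitSpace : ∀ k : Fin d, Module.finrank K (Φ.splitSpace k.succ) = 1
  split : ∀ k : Fin d, ∀ x ∈ Φ.splitSpace k.succ,
    (Φ.A - θ (Fin.rev k.castSucc) • 1) ((Φ.Astar - θs k.succ • 1) x) = φ k • x

/-- `τ_h = (λ - θ_0)(λ - θ_1) ⋯ (λ - θ_{h-1})`. -/
noncomputable def tau {d : ℕ} (θ : Fin (d + 1) → K) (h : ℕ) : K[X] :=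
  ∏ k ∈ Finset.univ.filter (fun k : Fin (d + 1) => (k : ℕ) < h), (X - C (θ k))

/-- `η_h = (λ - θ_d)(λ - θ_{d-1}) ⋯ (λ - θ_{d-h+1})`. -/
noncomputable def eta {d : ℕ} (θ : Fin (d + 1) → K) (h : ℕ) : K[X] :=
  ∏ k ∈ Finset.univ.filter (fun k : Fin (d + 1) => (k : ℕ) < h), (X - C (θ (Fin.rev k)))

/-- The value at `(x, y)` of the two-variable polynomial
`p = ∑_{h=0}^d η_h(λ) τ*_h(μ) / (φ_1 φ_2 ⋯ φ_h)`. -/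
noncomputable def twoVar {d : ℕ} (θ θs : Fin (d + 1) → K) (φ : Fin d → K) (x y : K) : K :=
  ∑ h : Fin (d + 1), (eta θ h).eval x * (tau θs h).eval y /
    ∏ k ∈ Finset.univ.filter (fun k : Fin d => (k : ℕ) < h), φ k

/-- The west-south normalized transition matrix `𝒫`, with `(i, j)`-entry `p(θ_i, θ*_j)`, of a TH
system with parameter array `(θ, θs, φ)`. -/
noncomputable def transitionMatrix {d : ℕ} (θ θs : Fin (d + 1) → K) (φ : Fin d → K) :
    Matrix (Fin (d + 1)) (Fin (d + 1)) K :=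
  Matrix.of fun i j => twoVar θ θs φ (θ i) (θs j)

end Systems

section Vandermonde

variable {K : Type u} [Field K]

/-- A graded sequence of polynomials `f 0, …, f n`. -/
def IsGraded {n : ℕ} (f : Fin (n + 1) → K[X]) : Prop :=
  f 0 = 1 ∧ ∀ i, (f i).degree = ((i : ℕ) : WithBot ℕ)

/-- `(X, θ)` is a west Vandermonde system: `X` is west Vandermonde and compatible with the sequence
`θ` of mutually distinct scalars. -/
structure IsWestVandermondeSystem {d : ℕ} (X : Matrix (Fin (d + 1)) (Fin (d + 1)) K)
    (θ : Fin (d + 1) → K) : Prop where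
  injective : Function.Injective θ
  exists_graded : ∃ f : Fin (d + 1) → K[X], IsGraded f ∧ ∀ i j, X i j = X i 0 * (f j).eval (θ i)
  ne_zero : ∀ i, X i 0 ≠ 0

/-- The matrix obtained by rotating `X` clockwise by 90 degrees. -/
def rotateClockwise {d : ℕ} (X : Matrix (Fin (d + 1)) (Fin (d + 1)) K) :
    Matrix (Fin (d + 1)) (Fin (d + 1)) K :=
  Matrix.of fun i j => X (Fin.rev j) i

/-- `(X, θs)` is a south Vandermonde system. -/
def IsSouthVandermondeSystem {d : ℕ} (X : Matrix (Fin (d + 1)) (Fin (d + 1)) K)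
    (θs : Fin (d + 1) → K) : Prop :=
  IsWestVandermondeSystem (rotateClockwise X) θs

/-- A normalized west-south Vandermonde system `(X, θ, θs)` in `Mat_{d+1}(K)`. -/
structure NormalizedWSVandermondeSystem (K : Type u) [Field K] (d : ℕ) where
  X : Matrix (Fin (d + 1)) (Fin (d + 1)) K
  θ : Fin (d + 1) → K
  θs : Fin (d + 1) → K
  west : IsWestVandermondeSystem X θ
  south : IsSouthVandermondeSystem X θs
  west_normalized : ∀ i, X i 0 = 1
  south_normalized : ∀ i, X (Fin.last d) i = 1

end Vandermonde

section Classes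

/-- A TH system over `K` of diameter `d`, together with its underlying vector space. -/
structure THSystemOver (K : Type u) [Field K] (d : ℕ) : Type (max u v + 1) where
  V : Type (max u v)
  [addCommGroup : AddCommGroup V]
  [module : Module K V]
  system : THSystem K V d

attribute [instance] THSystemOver.addCommGroup THSystemOver.module

/-- Isomorphism of TH systems is an equivalence relation. -/
instance isoSetoid (K : Type u) [Field K] (d : ℕ) : Setoid (THSystemOver.{u, v} K d) where
  r Φ Ψ := Φ.system.Isomorphic Ψ.system
  iseqv :=
    { refl := fun _ => ⟨AlgEquiv.refl, rfl, rfl, fun _ => rfl, fun _ => rfl⟩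
      symm := by
        rintro Φ Ψ ⟨γ, h1, h2, h3, h4⟩
        exact ⟨γ.symm, by simp [← h1], by simp [← h2], fun i => by simp [← h3 i],
          fun i => by simp [← h4 i]⟩
      trans := by
        rintro Φ Ψ Ω ⟨γ, h1, h2, h3, h4⟩ ⟨δ, k1, k2, k3, k4⟩
        exact ⟨γ.trans δ, by simp [h1, k1], by simp [h2, k2], fun i => by simp [h3 i, k3 i],
          fun i => by simp [h4 i, k4 i]⟩ }

/-- The isomorphism classes of TH systems over `K` of diameter `d`. -/
def THIsoClass (K : Type u) [Field K] (d : ℕ) : Type (max u v + 1) :=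
  Quotient (isoSetoid.{u, v} K d)

/-- The isomorphism class of a TH system. -/
def THSystem.isoClass {K : Type u} [Field K] {d : ℕ}
    {V : Type (max u v)} [AddCommGroup V] [Module K V] (Φ : THSystem K V d) :
    THIsoClass.{u, v} K d :=
  Quotient.mk (isoSetoid.{u, v} K d) (THSystemOver.mk V Φ)

/-- `T` is the transition matrix from the basis `b` to the basis `c`: `c_j = ∑_i T_{ij} b_i`. -/
def IsTransitionMatrix {K : Type u} [Field K] {V : Type w} [AddCommGroup V] [Module K V] {d : ℕ}
    (T : Matrix (Fin (d + 1)) (Fin (d + 1)) K) (b c : Module.Basis (Fin (d + 1)) K V) : Prop :=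
  ∀ j, c j = ∑ i, T i j • b i

/-- `Φ` is the sequence constructed from `(X, θ, θs)` and the bases `b`, `c`: `A b_i = θ_i b_i`,
`A* c_i = θ*_i c_i`, and `E_i`, `E*_i` are the primitive idempotents of `A`, `A*` corresponding to
`θ_i`, `θ*_i`. -/
structure THSystem.IsConstructedFrom {K : Type u} [Field K] {V : Type w} [AddCommGroup V]
    [Module K V] {d : ℕ} (Φ : THSystem K V d) (S : NormalizedWSVandermondeSystem K d)
    (b c : Module.Basis (Fin (d + 1)) K V) : Prop where
  A_apply : ∀ i, Φ.A (b i) = S.θ i • b i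
  Astar_apply : ∀ i, Φ.Astar (c i) = S.θs i • c i
  E_eq : ∀ i, IsPrimitiveIdempotent Φ.A (S.θ i) (Φ.E i)
  Estar_eq : ∀ i, IsPrimitiveIdempotent Φ.Astar (S.θs i) (Φ.Estar i)

/-- `ρ` is the map that sends the isomorphism class of each TH system `Φ` to `(𝒫, θ, θs)`, where
`𝒫` is the west-south normalized transition matrix of `Φ` and `θ`, `θs` are its eigenvalue and dual
eigenvalue sequences. (A TH system has at most one parameter array, so this pins `ρ` down; that it
has one is part of the claim.) -/
def IsRho {K : Type u} [Field K] {d : ℕ}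
    (ρ : THIsoClass.{u, v} K d → NormalizedWSVandermondeSystem K d) : Prop :=
  ∀ (V : Type (max u v)) [AddCommGroup V] [Module K V] (Φ : THSystem K V d),
    ∃ (θ θs : Fin (d + 1) → K) (φ : Fin d → K), Φ.HasParameterArray θ θs φ ∧
      (ρ (THSystem.isoClass.{u, v} Φ)).X = transitionMatrix θ θs φ ∧
      (ρ (THSystem.isoClass.{u, v} Φ)).θ = θ ∧
      (ρ (THSystem.isoClass.{u, v} Φ)).θs = θs

/-- `χ` is the map that sends each normalized west-south Vandermonde system `S = (X, θ, θs)` to the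
isomorphism class of the TH system constructed from `S` on any vector space `V` of dimension
`d + 1`, with any bases `b`, `c` of `V` such that `X` is the transition matrix from `b` to `c`.
(Such bases exist, and the construction gives a TH system: this is part of the claim.) -/
def IsChi {K : Type u} [Field K] {d : ℕ}
    (χ : NormalizedWSVandermondeSystem K d → THIsoClass.{u, v} K d) : Prop :=
  ∀ (S : NormalizedWSVandermondeSystem K d) (V : Type (max u v)) [AddCommGroup V] [Module K V],
    Module.finrank K V = d + 1 →
      (∃ b c : Module.Basis (Fin (d + 1)) K V, IsTransitionMatrix S.X b c) ∧
      ∀ b c : Module.Basis (Fin (d + 1)) K V, IsTransitionMatrix S.X b c →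
        ∃ Φ : THSystem K V d, Φ.IsConstructedFrom S b c ∧ χ S = THSystem.isoClass.{u, v} Φ

end Classes

end THVand

/-!
Let `b`, `c` be eigenbases of `A`, `A*`, and let `X` be the transition matrix from `b` to `c`. The
conditions on `E*_i A E*_j` say exactly that `A` is represented in the basis `c` by an upper
Hessenberg matrix with nonzero subdiagonal (`isHessenberg_iff`). This means that `A c_j` is a
nonzero multiple of `c_{j+1}` plus a combination of `c_0, …, c_j`; equivalently, `c_j = f_j(A) c_0`
with `f_j` of degree `j`, which, read in the coordinates given by `b`, is the west Vandermonde
property of `X` (`isHessenberg_iff_west`). Passing to transposes, the conditions on `E_i A* E_j`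
become the south Vandermonde property (`isHessenberg_iff_south`). Rescaling `b` and `c` makes the
first column and the last row of `X` equal to one. So every TH system is constructed from a
normalized west-south Vandermonde system (`THSystem.exists_corresponds`), and conversely
(`NormalizedWSVandermondeSystem.exists_isConstructedFrom`).

The relation `Corresponds` between TH systems and Vandermonde systems is thus total on both sides.
It relates a Vandermonde system to a single isomorphism class, since a linear map matching the
bases conjugates one TH system to the other, and since all isomorphisms between endomorphism
algebras are inner (`Corresponds.isomorphic`, `Corresponds.of_isomorphic`).

It remains to see that the system attached to `Φ` is `(𝒫, θ, θ*)`, which also makes it unique. Put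
`u_i = η_i(A) c_0`. Comparing the two descriptions of the flags shows that `u_i` spans the split
space `U_i`, that `(A - θ_{d-i+1}) u_{i-1} = u_i`, and that `(A* - θ*_i) u_i = φ_i u_{i-1}` with
`φ_i ≠ 0`. Hence `∑_h τ*_h(θ*_j) / (φ_1 ⋯ φ_h) u_h` is an eigenvector of `A*` for `θ*_j`, whose
`b_d`-coordinate is one, so it is `c_j`; its `b_i`-coordinate is `𝒫_{ij}`
(`THSystem.IsConstructedFrom.X_eq_transitionMatrix`).
-/

namespace THVand

open Polynomial

/-! ### Hessenberg matrices and Vandermonde systems -/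

section Hessenberg

variable {K : Type u} [Field K] {d : ℕ}

/-- Upper Hessenberg matrices with nowhere vanishing subdiagonal. -/
structure IsHessenberg (B : Matrix (Fin (d + 1)) (Fin (d + 1)) K) : Prop where
  eq_zero : ∀ i j : Fin (d + 1), (j : ℕ) + 1 < i → B i j = 0
  ne_zero : ∀ i j : Fin (d + 1), (i : ℕ) = j + 1 → B i j ≠ 0

lemma IsGraded.natDegree {f : Fin (d + 1) → K[X]} (hf : IsGraded f) (i : Fin (d + 1)) :
    (f i).natDegree = i :=
  natDegree_eq_of_degree_eq_some (hf.2 i)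

lemma IsGraded.coeff_ne_zero {f : Fin (d + 1) → K[X]} (hf : IsGraded f) (i : Fin (d + 1)) :
    (f i).coeff i ≠ 0 := by
  rw [← hf.natDegree i, coeff_natDegree, Ne, leadingCoeff_eq_zero]
  intro h
  have := hf.2 i
  simp [h] at this

/-- Polynomials of degree less than `n` are combinations of the first `n` terms of a graded
sequence. -/
lemma IsGraded.exists_coord {f : Fin (d + 1) → K[X]} (hf : IsGraded f) :
    ∀ n : ℕ, n ≤ d + 1 → ∀ p : K[X], p.degree < n →
      ∃ β : Fin (d + 1) → K, (∀ k : Fin (d + 1), n ≤ k → β k = 0) ∧ p = ∑ k, C (β k) * f k := by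
  intro n
  induction n with
  | zero =>
    intro _ p hp
    refine ⟨0, fun _ _ => rfl, ?_⟩
    have : p = 0 := by
      rw [← degree_eq_bot]
      simpa [Nat.WithBot.lt_zero_iff] using hp
    simp [this]
  | succ n ih =>
    intro hn p hp
    let m : Fin (d + 1) := ⟨n, hn⟩
    have hm := hf.coeff_ne_zero m
    obtain ⟨β, hβ, hpβ⟩ := ih (by omega) (p - C (p.coeff n / (f m).coeff n) * f m) (by
      rw [degree_lt_iff_coeff_zero]
      intro k hk
      rcases hk.eq_or_lt with rfl | hk
      · simp only [coeff_sub, coeff_C_mul]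
        rw [div_mul_cancel₀ _ hm, sub_self]
      · have hpk : p.coeff k = 0 :=
          coeff_eq_zero_of_degree_lt (hp.trans_le (Nat.cast_le.2 hk))
        have hfk : (f m).coeff k = 0 :=
          coeff_eq_zero_of_natDegree_lt (by rw [hf.natDegree m]; exact hk)
        rw [coeff_sub, coeff_C_mul, hpk, hfk, mul_zero, sub_zero])
    refine ⟨Function.update β m (p.coeff n / (f m).coeff n), ?_, ?_⟩
    · intro k hk
      rw [Function.update_of_ne, hβ k (by omega)]
      rintro rfl
      exact absurd hk (by simp [m])
    · rw [sub_eq_iff_eq_add] at hpβ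
      rw [Finset.sum_eq_add_sum_sdiff_singleton_of_mem (Finset.mem_univ m)] at hpβ ⊢
      rw [hβ m le_rfl, C_0, zero_mul, zero_add] at hpβ
      rw [Function.update_self]
      refine hpβ.trans ((add_comm _ _).trans (congrArg _ ?_))
      refine Finset.sum_congr rfl fun k hk => ?_
      rw [Function.update_of_ne]
      simpa using hk

lemma IsWestVandermondeSystem.isUnit_det {X : Matrix (Fin (d + 1)) (Fin (d + 1)) K}
    {θ : Fin (d + 1) → K} (h : IsWestVandermondeSystem X θ) : IsUnit X.det := by
  obtain ⟨f, hf, hX⟩ := h.exists_graded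
  have : X = Matrix.diagonal (fun i => X i 0) *
      (Matrix.vandermonde θ * Matrix.of fun i j : Fin (d + 1) => (f j).coeff i) := by
    rw [← Matrix.eval_matrixOfPolynomials_eq_vandermonde_mul_matrixOfPolynomials θ f
      (fun i => (hf.natDegree i).le)]
    ext i j
    rw [Matrix.diagonal_mul, hX i j]
    rfl
  rw [this, Matrix.det_mul, Matrix.det_mul, Matrix.det_diagonal, isUnit_iff_ne_zero]
  refine mul_ne_zero (Finset.prod_ne_zero_iff.2 fun i _ => h.ne_zero i) (mul_ne_zero
    (Matrix.det_vandermonde_ne_zero_iff.2 h.injective) ?_)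
  rw [Matrix.det_of_isUpperTriangular]
  · exact Finset.prod_ne_zero_iff.2 fun i _ => hf.coeff_ne_zero i
  · intro i j hij
    apply coeff_eq_zero_of_natDegree_lt
    rw [hf.natDegree]
    exact hij

/-- If `diag θ` becomes Hessenberg in the basis of columns of `X`, the columns of `X` are obtained
from the first one by applying polynomials in `diag θ`. -/
lemma IsHessenberg.west {X B : Matrix (Fin (d + 1)) (Fin (d + 1)) K} {θ : Fin (d + 1) → K}
    (hB : IsHessenberg B) (hθ : Function.Injective θ) (hX : IsUnit X.det)
    (h : Matrix.diagonal θ * X = X * B) : IsWestVandermondeSystem X θ := by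
  have key : ∀ n : ℕ, ∀ j : Fin (d + 1), (j : ℕ) = n → ∃ f : K[X], (j = 0 → f = 1) ∧
      f.degree = ((j : ℕ) : WithBot ℕ) ∧ ∀ i, X i j = X i 0 * f.eval (θ i) := by
    intro n
    induction n using Nat.strong_induction_on with
    | _ n ih =>
      rintro j rfl
      rcases Nat.eq_zero_or_pos (j : ℕ) with hj | hj
      · have hj0 : j = 0 := Fin.ext hj
        subst hj0
        exact ⟨1, fun _ => rfl, by simp, by simp⟩
      -- Column `l = j - 1` of the relation expresses column `j` of `X` through the columns before
      -- it, because `B j l ≠ 0`.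
      have IH : ∀ k : Fin (d + 1), ∃ f : K[X], k < j → f.degree = ((k : ℕ) : WithBot ℕ) ∧
          ∀ i, X i k = X i 0 * f.eval (θ i) := by
        intro k
        by_cases hk : k < j
        · obtain ⟨f, -, hf⟩ := ih k hk k rfl
          exact ⟨f, fun _ => hf⟩
        · exact ⟨0, fun h => absurd h hk⟩
      choose f hf using IH
      let l : Fin (d + 1) := ⟨j - 1, by omega⟩
      have hlj : l < j := by rw [Fin.lt_def]; simp only [l]; omega
      have hb : B j l ≠ 0 := hB.ne_zero j l (by simp only [l]; omega)
      have hlow : (∑ k ∈ Finset.univ.filter (· < j), C (B k l) * f k).degree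
          < ((j : ℕ) : WithBot ℕ) := by
        refine (degree_sum_le _ _).trans_lt ((Finset.sup_lt_iff ?_).2 fun k hk => ?_)
        · exact WithBot.bot_lt_coe _
        · have hk : k < j := by simpa using hk
          rw [← smul_eq_C_mul]
          refine (degree_smul_le _ _).trans_lt ?_
          rw [(hf k hk).1]
          exact_mod_cast hk
      have htop : (Polynomial.X * f l).degree = ((j : ℕ) : WithBot ℕ) := by
        rw [degree_mul, degree_X, (hf l hlj).1, ← Nat.cast_one, ← Nat.cast_add]
        congr 1
        simp only [l]; omega
      refine ⟨C (B j l)⁻¹ * (Polynomial.X * f l -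
        ∑ k ∈ Finset.univ.filter (· < j), C (B k l) * f k), ?_, ?_, ?_⟩
      · rintro rfl
        exact absurd hj (by simp)
      · rw [degree_C_mul (inv_ne_zero hb), degree_sub_eq_left_of_degree_lt (htop ▸ hlow), htop]
      · intro i
        have hi := congrFun (congrFun h i) l
        rw [Matrix.diagonal_mul, Matrix.mul_apply,
          ← Finset.sum_filter_add_sum_filter_not _ (· < j),
          Finset.sum_eq_single_of_mem j (s := Finset.univ.filter (¬ · < j)) (by simp)] at hi
        · have hs : ∑ k ∈ Finset.univ.filter (· < j), X i k * B k l =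
              X i 0 * ∑ k ∈ Finset.univ.filter (· < j), B k l * (f k).eval (θ i) := by
            rw [Finset.mul_sum]
            refine Finset.sum_congr rfl fun k hk => ?_
            rw [(hf k (by simpa using hk)).2 i]
            ring
          rw [hs, (hf l hlj).2 i] at hi
          simp only [eval_mul, eval_C, eval_sub, eval_X, eval_finsetSum]
          field_simp
          linear_combination -hi
        · intro k hk hkj
          rw [hB.eq_zero k l, mul_zero]
          have : j ≤ k := by simpa using hk
          have : j < k := lt_of_le_of_ne this (Ne.symm hkj)
          simp only [l]
          have := Fin.lt_def.1 this
          omega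
  choose f h0 hdeg hf using fun j : Fin (d + 1) => key j j rfl
  refine ⟨hθ, ⟨f, ⟨h0 0 rfl, hdeg⟩, fun i j => hf j i⟩, fun i hi => ?_⟩
  refine hX.ne_zero (Matrix.det_eq_zero_of_row_eq_zero i fun j => ?_)
  rw [hf j i, hi, zero_mul]

/-- Converse of `IsHessenberg.west`: multiplication by `λ` raises the degree in a graded sequence by
exactly one. -/
lemma IsWestVandermondeSystem.hessenberg {X B : Matrix (Fin (d + 1)) (Fin (d + 1)) K}
    {θ : Fin (d + 1) → K} (hX : IsWestVandermondeSystem X θ)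
    (h : Matrix.diagonal θ * X = X * B) : IsHessenberg B := by
  have hdet := hX.isUnit_det
  obtain ⟨f, hf, hXf⟩ := hX.exists_graded
  -- In column `j < d`, the entries of `B` are the coordinates of `λ f_j` in the sequence `f`.
  have key : ∀ j : Fin (d + 1), (j : ℕ) < d → (∀ i : Fin (d + 1), (j : ℕ) + 1 < i → B i j = 0) ∧
      ∀ i : Fin (d + 1), (i : ℕ) = j + 1 → B i j ≠ 0 := by
    intro j hj
    have hdeg : (Polynomial.X * f j).degree = ((j + 1 : ℕ) : WithBot ℕ) := by
      rw [degree_mul, degree_X, hf.2 j, Nat.cast_add, Nat.cast_one, add_comm]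
    obtain ⟨β, hβ, hp⟩ := hf.exists_coord (j + 2) (by omega) (Polynomial.X * f j) (by
      rw [hdeg]; exact_mod_cast Nat.lt_succ_self _)
    have hcol : (fun i => B i j) = β := by
      have hinj := Matrix.mulVec_injective_of_isUnit ((Matrix.isUnit_iff_isUnit_det X).2 hdet)
      apply hinj
      ext i
      have hi := congrFun (congrFun h i) j
      rw [Matrix.diagonal_mul, Matrix.mul_apply] at hi
      have he := congrArg (fun q : K[X] => X i 0 * q.eval (θ i)) hp
      simp only [eval_mul, eval_X, eval_finsetSum, eval_C, Finset.mul_sum] at he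
      rw [Matrix.mulVec, dotProduct, ← hi, hXf i j, Matrix.mulVec, dotProduct]
      rw [mul_left_comm, he]
      refine Finset.sum_congr rfl fun k _ => ?_
      rw [hXf i k]
      ring
    have hcol' : ∀ i, B i j = β i := congrFun hcol
    refine ⟨fun i hi => by rw [hcol', hβ i hi], fun i hi h0 => ?_⟩
    rw [hcol'] at h0
    have hlt : (∑ k, C (β k) * f k).degree < ((j + 1 : ℕ) : WithBot ℕ) := by
      refine (degree_sum_le _ _).trans_lt ((Finset.sup_lt_iff (WithBot.bot_lt_coe _)).2
        fun k _ => ?_)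
      by_cases hk : (k : ℕ) < j + 1
      · rw [← smul_eq_C_mul]
        refine (degree_smul_le _ _).trans_lt ?_
        rw [hf.2 k]
        exact_mod_cast hk
      · have : β k = 0 := by
          rcases (not_lt.1 hk).eq_or_lt with hk | hk
          · rw [← h0]
            congr 1
            exact Fin.ext (by omega)
          · exact hβ k hk
        rw [this, C_0, zero_mul, degree_zero]
        exact WithBot.bot_lt_coe _
    rw [← hp, hdeg] at hlt
    exact lt_irrefl _ hlt
  exact ⟨fun i j hij => (key j (by omega)).1 i hij, fun i j hij => (key j (by omega)).2 i hij⟩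

/-- Reversing rows and columns of the transpose preserves the Hessenberg shape. -/
lemma isHessenberg_flip {M : Matrix (Fin (d + 1)) (Fin (d + 1)) K} :
    IsHessenberg (Matrix.of fun i j => M (Fin.rev j) (Fin.rev i)) ↔ IsHessenberg M := by
  constructor
  · intro h
    refine ⟨fun i j hij => ?_, fun i j hij => ?_⟩
    · simpa using h.eq_zero (Fin.rev j) (Fin.rev i) (by simp only [Fin.val_rev]; omega)
    · simpa using h.ne_zero (Fin.rev j) (Fin.rev i) (by simp only [Fin.val_rev]; omega)
  · intro h
    refine ⟨fun i j hij => ?_, fun i j hij => ?_⟩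
    · exact h.eq_zero (Fin.rev j) (Fin.rev i) (by simp only [Fin.val_rev]; omega)
    · exact h.ne_zero (Fin.rev j) (Fin.rev i) (by simp only [Fin.val_rev]; omega)

/-- The rotation turns a relation `M X = X diag θs` on rows into one on columns. -/
lemma diagonal_mul_rotateClockwise {X M : Matrix (Fin (d + 1)) (Fin (d + 1)) K}
    {θs : Fin (d + 1) → K} (h : M * X = X * Matrix.diagonal θs) :
    Matrix.diagonal θs * rotateClockwise X =
      rotateClockwise X * Matrix.of fun i j => M (Fin.rev j) (Fin.rev i) := by
  ext i j
  have := congrFun (congrFun h (Fin.rev j)) i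
  rw [Matrix.mul_diagonal, Matrix.mul_apply] at this
  rw [Matrix.diagonal_mul, Matrix.mul_apply]
  simp only [rotateClockwise, Matrix.of_apply]
  rw [mul_comm, ← this, ← Equiv.sum_comp Fin.revPerm]
  exact Finset.sum_congr rfl fun k _ => by simp [mul_comm]

lemma isUnit_det_rotateClockwise {X : Matrix (Fin (d + 1)) (Fin (d + 1)) K} (h : IsUnit X.det) :
    IsUnit (rotateClockwise X).det := by
  have : rotateClockwise X = (X.submatrix Fin.revPerm id).transpose := rfl
  rw [this, Matrix.det_transpose, Matrix.det_permute]
  exact ((Units.isUnit _).map (Int.castRingHom K)).mul h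

end Hessenberg

/-! ### Multiplicity-free maps in an eigenbasis -/

section Eigenbasis

variable {K : Type u} [Field K] {d : ℕ} {V : Type w} [AddCommGroup V] [Module K V]
  {A T : Module.End K V} {θ : Fin (d + 1) → K} {b c : Module.Basis (Fin (d + 1)) K V}

lemma repr_apply_eq_sum (T : Module.End K V) (b : Module.Basis (Fin (d + 1)) K V) (x : V)
    (i : Fin (d + 1)) : b.repr (T x) i = ∑ j, b.repr x j * b.repr (T (b j)) i := by
  conv_lhs => rw [← b.sum_repr x]
  simp only [map_sum, map_smul, Finsupp.finsetSum_apply, Finsupp.smul_apply, smul_eq_mul]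

lemma repr_apply_of_eigenbasis (hA : ∀ i, A (b i) = θ i • b i) (x : V) (i : Fin (d + 1)) :
    b.repr (A x) i = θ i * b.repr x i := by
  have : (b.coord i).comp A = θ i • b.coord i := by
    refine b.ext fun j => ?_
    simp only [LinearMap.comp_apply, hA, map_smul, LinearMap.smul_apply, Module.Basis.coord_apply,
      Module.Basis.repr_self, smul_eq_mul, Finsupp.single_apply]
    split_ifs with h
    · rw [h]
    · simp
  exact LinearMap.congr_fun this x

lemma repr_aeval_of_eigenbasis (hA : ∀ i, A (b i) = θ i • b i) (p : K[X]) (x : V)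
    (i : Fin (d + 1)) : b.repr (aeval A p x) i = p.eval (θ i) * b.repr x i := by
  induction p using Polynomial.induction_on' with
  | add p q hp hq => simp [hp, hq, add_mul]
  | monomial n a =>
    rw [aeval_monomial, eval_monomial]
    simp only [Module.End.mul_apply, Module.algebraMap_end_apply, map_smul, Finsupp.smul_apply,
      smul_eq_mul, mul_assoc]
    congr 1
    induction n with
    | zero => simp
    | succ n ih => rw [pow_succ', Module.End.mul_apply, repr_apply_of_eigenbasis hA, ih]; ring

lemma mem_eigenspace_iff_repr (hA : ∀ i, A (b i) = θ i • b i) (μ : K) (x : V) :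
    x ∈ A.eigenspace μ ↔ ∀ i, θ i ≠ μ → b.repr x i = 0 := by
  rw [Module.End.mem_eigenspace_iff]
  constructor
  · intro h i hi
    have h1 := repr_apply_of_eigenbasis hA x i
    rw [h, map_smul, Finsupp.smul_apply, smul_eq_mul] at h1
    by_contra h0
    exact hi (mul_right_cancel₀ h0 h1).symm
  · intro h
    refine b.ext_elem fun i => ?_
    rw [repr_apply_of_eigenbasis hA, map_smul, Finsupp.smul_apply, smul_eq_mul]
    by_cases hi : θ i = μ
    · rw [hi]
    · rw [h i hi, mul_zero, mul_zero]

lemma eq_smul_of_repr_eq_zero {x : V} {i : Fin (d + 1)} (h : ∀ j, j ≠ i → b.repr x j = 0) :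
    x = b.repr x i • b i := by
  refine b.ext_elem fun j => ?_
  rw [map_smul, Finsupp.smul_apply, b.repr_self, Finsupp.single_apply]
  split_ifs with hij
  · simp [hij]
  · simp [h j (Ne.symm hij)]

lemma eigenspace_eq_span (hθ : Function.Injective θ) (hA : ∀ i, A (b i) = θ i • b i)
    (i : Fin (d + 1)) : A.eigenspace (θ i) = K ∙ b i := by
  refine le_antisymm (fun x hx => ?_) ?_
  · rw [mem_eigenspace_iff_repr hA] at hx
    rw [eq_smul_of_repr_eq_zero (b := b) (x := x) (i := i) fun j hj => hx j (hθ.ne hj)]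
    exact Submodule.smul_mem _ _ (Submodule.mem_span_singleton_self _)
  · rw [Submodule.span_singleton_le_iff_mem, Module.End.mem_eigenspace_iff, hA]

lemma hasEigenvalue_of_eigenbasis (hA : ∀ i, A (b i) = θ i • b i) (i : Fin (d + 1)) :
    A.HasEigenvalue (θ i) :=
  Module.End.hasEigenvalue_of_hasEigenvector (x := b i)
    ⟨Module.End.mem_eigenspace_iff.2 (hA i), b.ne_zero i⟩

lemma exists_eq_of_hasEigenvalue (hA : ∀ i, A (b i) = θ i • b i) {μ : K}
    (hμ : A.HasEigenvalue μ) : ∃ i, θ i = μ := by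
  obtain ⟨x, hx, hx0⟩ := hμ.exists_hasEigenvector
  by_contra! h
  rw [mem_eigenspace_iff_repr hA] at hx
  exact hx0 (b.ext_elem fun i => by rw [hx i (h i)]; simp)

lemma isMultiplicityFree_of_eigenbasis (hθ : Function.Injective θ)
    (hA : ∀ i, A (b i) = θ i • b i) : IsMultiplicityFree A := by
  refine ⟨eq_top_iff.2 ?_, fun μ hμ => ?_⟩
  · rw [← b.span_eq, Submodule.span_le]
    rintro _ ⟨i, rfl⟩
    exact Submodule.mem_iSup_of_mem (θ i) (Module.End.mem_eigenspace_iff.2 (hA i))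
  · obtain ⟨i, rfl⟩ := exists_eq_of_hasEigenvalue hA hμ
    rw [eigenspace_eq_span hθ hA, finrank_span_singleton (b.ne_zero i)]

/-- In an eigenbasis, the primitive idempotents are the coordinate projections. -/
lemma isPrimitiveIdempotent_iff (hθ : Function.Injective θ) (hA : ∀ i, A (b i) = θ i • b i)
    {i : Fin (d + 1)} {E : Module.End K V} :
    IsPrimitiveIdempotent A (θ i) E ↔ ∀ x, E x = b.repr x i • b i := by
  constructor
  · intro h x
    have : E = (b.coord i).smulRight (b i) := by
      refine b.ext fun j => ?_
      rw [LinearMap.smulRight_apply, b.coord_apply, b.repr_self, Finsupp.single_apply]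
      split_ifs with hji
      · rw [hji, one_smul]
        exact h.apply_self _ (Module.End.mem_eigenspace_iff.2 (hA i))
      · rw [zero_smul]
        exact h.apply_other (θ j) (hθ.ne hji) _ (Module.End.mem_eigenspace_iff.2 (hA j))
    rw [this]
    rfl
  · intro h
    refine ⟨hasEigenvalue_of_eigenbasis hA i, fun x hx => ?_, fun μ hμ x hx => ?_⟩
    · rw [mem_eigenspace_iff_repr hA] at hx
      rw [h]
      exact (eq_smul_of_repr_eq_zero fun j hj => hx j (hθ.ne hj)).symm
    · rw [mem_eigenspace_iff_repr hA] at hx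
      rw [h, hx i hμ.symm, zero_smul]

lemma isPrimitiveIdempotentOrdering_of_eigenbasis (hθ : Function.Injective θ)
    (hA : ∀ i, A (b i) = θ i • b i) {E : Fin (d + 1) → Module.End K V}
    (hE : ∀ i, IsPrimitiveIdempotent A (θ i) (E i)) : IsPrimitiveIdempotentOrdering A E := by
  refine ⟨fun i => ⟨θ i, hE i⟩, fun i j hij => ?_, fun μ F hF => ?_⟩
  · by_contra hne
    have h1 := (isPrimitiveIdempotent_iff hθ hA).1 (hE i) (b i)
    rw [hij, (isPrimitiveIdempotent_iff hθ hA).1 (hE j)] at h1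
    simp [hne, Ne.symm (b.ne_zero i)] at h1
  · obtain ⟨i, rfl⟩ := exists_eq_of_hasEigenvalue hA hF.hasEigenvalue
    refine ⟨i, LinearMap.ext fun x => ?_⟩
    rw [(isPrimitiveIdempotent_iff hθ hA).1 (hE i), (isPrimitiveIdempotent_iff hθ hA).1 hF]

lemma range_eq_span_of_eigenbasis {E : Module.End K V} {i : Fin (d + 1)}
    (hE : ∀ x, E x = b.repr x i • b i) : LinearMap.range E = K ∙ b i := by
  refine le_antisymm ?_ ?_
  · rintro _ ⟨x, rfl⟩
    rw [hE]
    exact Submodule.smul_mem _ _ (Submodule.mem_span_singleton_self _)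
  · rw [Submodule.span_singleton_le_iff_mem]
    exact ⟨b i, by rw [hE]; simp⟩

lemma mem_iSup_span_iff {x : V} {n : Fin (d + 1)} :
    x ∈ (⨆ j : Fin (d + 1), ⨆ _ : j ≤ n, K ∙ b j) ↔ ∀ k, n < k → b.repr x k = 0 := by
  constructor
  · intro hx k hk
    have : (⨆ j : Fin (d + 1), ⨆ _ : j ≤ n, K ∙ b j) ≤ LinearMap.ker (b.coord k) := by
      refine iSup₂_le fun j hj => ?_
      rw [Submodule.span_singleton_le_iff_mem, LinearMap.mem_ker, b.coord_apply, b.repr_self,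
        Finsupp.single_eq_of_ne (hj.trans_lt hk).ne']
    exact this hx
  · intro h
    rw [← b.sum_repr x]
    refine Submodule.sum_mem _ fun j _ => ?_
    by_cases hj : j ≤ n
    · exact Submodule.smul_mem _ _ (Submodule.mem_iSup_of_mem j (Submodule.mem_iSup_of_mem hj
        (Submodule.mem_span_singleton_self _)))
    · rw [h j (not_le.1 hj), zero_smul]
      exact Submodule.zero_mem _

lemma mul_mul_eq_zero_iff {E : Fin (d + 1) → Module.End K V}
    (hE : ∀ i x, E i x = b.repr x i • b i) (i j : Fin (d + 1)) :
    E i * T * E j = 0 ↔ b.repr (T (b j)) i = 0 := by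
  constructor
  · intro h
    have := LinearMap.congr_fun h (b j)
    simpa [hE, b.ne_zero] using this
  · intro h
    ext x
    simp [hE, h]

/-- The vanishing conditions on `E i T E j` say that the matrix of `T` in the basis is
Hessenberg. -/
lemma isHessenberg_iff {E : Fin (d + 1) → Module.End K V}
    (hE : ∀ i x, E i x = b.repr x i • b i) :
    IsHessenberg (b.toMatrix fun j => T (b j)) ↔
      (∀ i j : Fin (d + 1), (j : ℕ) + 1 < i → E i * T * E j = 0) ∧
        ∀ i j : Fin (d + 1), (i : ℕ) = j + 1 → E i * T * E j ≠ 0 := by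
  simp only [Ne, mul_mul_eq_zero_iff hE]
  exact ⟨fun h => ⟨h.1, h.2⟩, fun h => ⟨h.1, h.2⟩⟩

lemma isUnit_det_toMatrix (b c : Module.Basis (Fin (d + 1)) K V) : IsUnit (b.toMatrix c).det :=
  haveI := b.invertibleToMatrix c
  Matrix.isUnit_det_of_invertible _

lemma isTransitionMatrix_iff {X : Matrix (Fin (d + 1)) (Fin (d + 1)) K} :
    IsTransitionMatrix X b c ↔ b.toMatrix c = X := by
  constructor
  · intro h
    ext i j
    rw [Module.Basis.toMatrix_apply, h j]
    simp [Finsupp.single_apply]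
  · rintro rfl j
    exact (b.sum_toMatrix_smul_self c j).symm

lemma diagonal_mul_toMatrix (hA : ∀ i, A (b i) = θ i • b i) :
    Matrix.diagonal θ * b.toMatrix c = b.toMatrix c * c.toMatrix fun j => A (c j) := by
  rw [Module.Basis.toMatrix_mul_toMatrix]
  ext i j
  rw [Matrix.diagonal_mul, Module.Basis.toMatrix_apply, Module.Basis.toMatrix_apply,
    repr_apply_of_eigenbasis hA]

lemma toMatrix_mul_diagonal (hA : ∀ i, A (c i) = θ i • c i) :
    (b.toMatrix fun j => A (b j)) * b.toMatrix c = b.toMatrix c * Matrix.diagonal θ := by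
  ext i j
  rw [Matrix.mul_diagonal, Module.Basis.toMatrix_apply, Matrix.mul_apply]
  have h := congrArg (fun x => b.repr x i) (hA j)
  simp only [map_smul, Finsupp.smul_apply, smul_eq_mul] at h
  rw [mul_comm, ← h, repr_apply_eq_sum]
  exact Finset.sum_congr rfl fun k _ => mul_comm _ _

lemma isHessenberg_iff_west (hθ : Function.Injective θ) (hA : ∀ i, A (b i) = θ i • b i) :
    IsHessenberg (c.toMatrix fun j => A (c j)) ↔ IsWestVandermondeSystem (b.toMatrix c) θ :=
  ⟨fun h => h.west hθ (isUnit_det_toMatrix b c) (diagonal_mul_toMatrix hA),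
    fun h => h.hessenberg (diagonal_mul_toMatrix hA)⟩

lemma isHessenberg_iff_south (hθ : Function.Injective θ) (hA : ∀ i, A (c i) = θ i • c i) :
    IsHessenberg (b.toMatrix fun j => A (b j)) ↔ IsSouthVandermondeSystem (b.toMatrix c) θ := by
  have h := diagonal_mul_rotateClockwise (toMatrix_mul_diagonal (b := b) hA)
  rw [← isHessenberg_flip]
  exact ⟨fun hB => hB.west hθ (isUnit_det_rotateClockwise (isUnit_det_toMatrix b c)) h,
    fun hX => IsWestVandermondeSystem.hessenberg hX h⟩

end Eigenbasis

/-! ### The correspondence between TH systems and Vandermonde systems -/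

section Correspondence

variable {K : Type u} [Field K] {d : ℕ} {V : Type w} [AddCommGroup V] [Module K V]
  {W : Type w'} [AddCommGroup W] [Module K W]

lemma IsPrimitiveIdempotent.eigenvalue_unique {A E : Module.End K V} {θ μ : K}
    (h : IsPrimitiveIdempotent A θ E) (h' : IsPrimitiveIdempotent A μ E) : θ = μ := by
  obtain ⟨x, hx, hx0⟩ := h.hasEigenvalue.exists_hasEigenvector
  by_contra hne
  exact hx0 ((h.apply_self x hx).symm.trans (h'.apply_other θ hne x hx))

lemma IsPrimitiveIdempotent.unique {A E F : Module.End K V} {θ : K} (hA : IsMultiplicityFree A)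
    (h : IsPrimitiveIdempotent A θ E) (h' : IsPrimitiveIdempotent A θ F) : E = F := by
  have : (⨆ μ : K, A.eigenspace μ) ≤ LinearMap.eqLocus E F := by
    refine iSup_le fun μ x hx => ?_
    rw [LinearMap.mem_eqLocus]
    by_cases hμ : μ = θ
    · subst hμ
      rw [h.apply_self x hx, h'.apply_self x hx]
    · rw [h.apply_other μ hμ x hx, h'.apply_other μ hμ x hx]
  rw [hA.1] at this
  exact LinearMap.ext fun x => this (Submodule.mem_top (x := x))

lemma exists_eigenbasis {A : Module.End K V} {E : Fin (d + 1) → Module.End K V}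
    (hV : Module.finrank K V = d + 1) (hA : IsMultiplicityFree A)
    (hE : IsPrimitiveIdempotentOrdering A E) :
    ∃ (θ : Fin (d + 1) → K) (b : Module.Basis (Fin (d + 1)) K V), Function.Injective θ ∧
      (∀ i, A (b i) = θ i • b i) ∧ ∀ i, IsPrimitiveIdempotent A (θ i) (E i) := by
  choose θ hθ using hE.isPrimitive
  have hinj : Function.Injective θ := fun i j hij =>
    hE.injective ((hθ i).unique hA (hij ▸ hθ j))
  choose v hv using fun i => (hθ i).hasEigenvalue.exists_hasEigenvector
  have hli := A.eigenvectors_linearIndependent' θ hinj v hv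
  refine ⟨θ, basisOfLinearIndependentOfCardEqFinrank hli (by simp [hV]), hinj, fun i => ?_, hθ⟩
  rw [coe_basisOfLinearIndependentOfCardEqFinrank]
  exact (hv i).apply_eq_smul

/-- `Φ` and `S` correspond to each other: `Φ` is constructed from `S` for some choice of bases. -/
def Corresponds (Φ : THSystem K V d) (S : NormalizedWSVandermondeSystem K d) : Prop :=
  ∃ b c : Module.Basis (Fin (d + 1)) K V, IsTransitionMatrix S.X b c ∧ Φ.IsConstructedFrom S b c

/-- The eigenvectors are scaled so that the first column and the last row of the transition matrix
consist of ones. -/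
lemma THSystem.exists_corresponds (Φ : THSystem K V d) : ∃ S, Corresponds Φ S := by
  obtain ⟨θ, b, hθ, hb, hE⟩ := exists_eigenbasis Φ.finrank_eq Φ.multiplicityFree Φ.ordering
  obtain ⟨θs, c, hθs, hc, hEs⟩ :=
    exists_eigenbasis Φ.finrank_eq Φ.multiplicityFree_star Φ.ordering_star
  have hvand : ∀ b c : Module.Basis (Fin (d + 1)) K V, (∀ i, Φ.A (b i) = θ i • b i) →
      (∀ i, Φ.Astar (c i) = θs i • c i) → IsWestVandermondeSystem (b.toMatrix c) θ ∧
        IsSouthVandermondeSystem (b.toMatrix c) θs := by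
    intro b c hb hc
    rw [← isHessenberg_iff_west hθ hb, ← isHessenberg_iff_south hθs hc,
      isHessenberg_iff fun i => (isPrimitiveIdempotent_iff hθ hb).1 (hE i),
      isHessenberg_iff fun i => (isPrimitiveIdempotent_iff hθs hc).1 (hEs i)]
    exact ⟨⟨Φ.Estar_A_Estar_eq_zero, Φ.Estar_A_Estar_ne_zero⟩,
      Φ.E_Astar_E_eq_zero, Φ.E_Astar_E_ne_zero⟩
  obtain ⟨hw, hs⟩ := hvand b c hb hc
  have hcol : ∀ i, b.repr (c 0) i ≠ 0 := hw.ne_zero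
  have hrow : ∀ j, b.repr (c j) (Fin.last d) ≠ 0 := fun j => by
    simpa [rotateClockwise, Module.Basis.toMatrix_apply] using hs.ne_zero j
  let b' := b.isUnitSMul (w := fun i => b.repr (c 0) i) fun i => (hcol i).isUnit
  let c' := c.isUnitSMul
    (w := fun j => b.repr (c 0) (Fin.last d) / b.repr (c j) (Fin.last d))
    fun j => (div_ne_zero (hrow 0) (hrow j)).isUnit
  have hb' : ∀ i, b' i = b.repr (c 0) i • b i := fun i => b.isUnitSMul_apply _ i
  have hc' : ∀ j, c' j = (b.repr (c 0) (Fin.last d) / b.repr (c j) (Fin.last d)) • c j :=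
    fun j => c.isUnitSMul_apply _ j
  have hX : ∀ i j, b'.toMatrix c' i j = (b.repr (c 0) i)⁻¹ *
      ((b.repr (c 0) (Fin.last d) / b.repr (c j) (Fin.last d)) * b.repr (c j) i) := by
    intro i j
    rw [Module.Basis.toMatrix_apply, hc', map_smul, Finsupp.smul_apply, smul_eq_mul,
      Module.Basis.repr_isUnitSMul, Units.smul_def, Units.val_inv_eq_inv_val, IsUnit.unit_spec,
      smul_eq_mul]
    ring
  have hbA : ∀ i, Φ.A (b' i) = θ i • b' i := fun i => by
    rw [hb', map_smul, hb, smul_comm]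
  have hcA : ∀ i, Φ.Astar (c' i) = θs i • c' i := fun i => by
    rw [hc', map_smul, hc, smul_comm]
  obtain ⟨hw', hs'⟩ := hvand b' c' hbA hcA
  refine ⟨⟨b'.toMatrix c', θ, θs, hw', hs', fun i => ?_, fun j => ?_⟩, b', c',
    isTransitionMatrix_iff.2 rfl, hbA, hcA, hE, hEs⟩
  · rw [hX, div_self (hrow 0), one_mul, inv_mul_cancel₀ (hcol i)]
  · rw [hX, div_mul_cancel₀ _ (hrow j), inv_mul_cancel₀ (hcol _)]

lemma NormalizedWSVandermondeSystem.exists_bases (S : NormalizedWSVandermondeSystem K d)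
    (hV : Module.finrank K V = d + 1) :
    ∃ b c : Module.Basis (Fin (d + 1)) K V, IsTransitionMatrix S.X b c := by
  let b : Module.Basis (Fin (d + 1)) K V :=
    haveI := Module.finite_of_finrank_eq_succ hV
    Module.finBasisOfFinrankEq K V hV
  refine ⟨b, b.map (Matrix.toLinearEquiv b S.X S.west.isUnit_det), fun j => ?_⟩
  rw [Module.Basis.map_apply]
  exact Matrix.toLin_self b b S.X j

lemma NormalizedWSVandermondeSystem.exists_isConstructedFrom
    (S : NormalizedWSVandermondeSystem K d) (hV : Module.finrank K V = d + 1)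
    {b c : Module.Basis (Fin (d + 1)) K V} (hX : IsTransitionMatrix S.X b c) :
    ∃ Φ : THSystem K V d, Φ.IsConstructedFrom S b c := by
  rw [isTransitionMatrix_iff] at hX
  let A : Module.End K V := b.constr K fun i => S.θ i • b i
  let As : Module.End K V := c.constr K fun i => S.θs i • c i
  let E : Fin (d + 1) → Module.End K V := fun i => (b.coord i).smulRight (b i)
  let Es : Fin (d + 1) → Module.End K V := fun i => (c.coord i).smulRight (c i)
  have hA : ∀ i, A (b i) = S.θ i • b i := fun i => b.constr_basis K _ i
  have hAs : ∀ i, As (c i) = S.θs i • c i := fun i => c.constr_basis K _ i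
  have hE : ∀ i, IsPrimitiveIdempotent A (S.θ i) (E i) := fun i =>
    (isPrimitiveIdempotent_iff S.west.injective hA).2 fun _ => rfl
  have hEs : ∀ i, IsPrimitiveIdempotent As (S.θs i) (Es i) := fun i =>
    (isPrimitiveIdempotent_iff S.south.injective hAs).2 fun _ => rfl
  have hw := S.west
  have hs := S.south
  rw [← hX, ← isHessenberg_iff_west S.west.injective hA,
    isHessenberg_iff (E := Es) fun _ _ => rfl] at hw
  rw [← hX, ← isHessenberg_iff_south S.south.injective hAs,
    isHessenberg_iff (E := E) fun _ _ => rfl] at hs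
  exact ⟨⟨hV, A, E, As, Es, isMultiplicityFree_of_eigenbasis S.west.injective hA,
    isMultiplicityFree_of_eigenbasis S.south.injective hAs,
    isPrimitiveIdempotentOrdering_of_eigenbasis S.west.injective hA hE,
    isPrimitiveIdempotentOrdering_of_eigenbasis S.south.injective hAs hEs,
    hs.1, hs.2, hw.1, hw.2⟩, hA, hAs, hE, hEs⟩

lemma Corresponds.isomorphic {Φ : THSystem K V d} {Ψ : THSystem K W d}
    {S : NormalizedWSVandermondeSystem K d} (hΦ : Corresponds Φ S) (hΨ : Corresponds Ψ S) :
    Φ.Isomorphic Ψ := by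
  obtain ⟨b, c, hX, h⟩ := hΦ
  obtain ⟨b', c', hX', h'⟩ := hΨ
  let f : V ≃ₗ[K] W := b.equiv b' (Equiv.refl _)
  have hfb : ∀ i, f (b i) = b' i := fun i => b.equiv_apply i b' _
  have hfc : ∀ j, f (c j) = c' j := fun j => by
    rw [hX j, hX' j, map_sum]
    exact Finset.sum_congr rfl fun i _ => by rw [map_smul, hfb]
  have hsb : ∀ i, f.symm (b' i) = b i := fun i => by rw [← hfb, f.symm_apply_apply]
  have hsc : ∀ i, f.symm (c' i) = c i := fun i => by rw [← hfc, f.symm_apply_apply]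
  refine ⟨f.conjAlgEquiv K, b'.ext fun i => ?_, c'.ext fun i => ?_, fun i => b'.ext fun j => ?_,
    fun i => c'.ext fun j => ?_⟩
  · simp [LinearEquiv.conjAlgEquiv_apply, hsb, h.A_apply, h'.A_apply, hfb]
  · simp [LinearEquiv.conjAlgEquiv_apply, hsc, h.Astar_apply, h'.Astar_apply, hfc]
  · simp [LinearEquiv.conjAlgEquiv_apply, hsb, Finsupp.single_apply,
      (isPrimitiveIdempotent_iff S.west.injective h.A_apply).1 (h.E_eq i),
      (isPrimitiveIdempotent_iff S.west.injective h'.A_apply).1 (h'.E_eq i)]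
    split_ifs <;> simp [hfb]
  · simp [LinearEquiv.conjAlgEquiv_apply, hsc, Finsupp.single_apply,
      (isPrimitiveIdempotent_iff S.south.injective h.Astar_apply).1 (h.Estar_eq i),
      (isPrimitiveIdempotent_iff S.south.injective h'.Astar_apply).1 (h'.Estar_eq i)]
    split_ifs <;> simp [hfc]

/-- Algebra isomorphisms between endomorphism algebras are inner, so an isomorphism of TH systems
transports the bases. -/
lemma Corresponds.of_isomorphic {Φ : THSystem K V d} {Ψ : THSystem K W d}
    {S : NormalizedWSVandermondeSystem K d} (hΦ : Corresponds Φ S) (h : Φ.Isomorphic Ψ) :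
    Corresponds Ψ S := by
  obtain ⟨b, c, hX, hc⟩ := hΦ
  obtain ⟨γ, hA, hAs, hE, hEs⟩ := h
  obtain ⟨f, rfl⟩ := γ.eq_linearEquivConjAlgEquiv
  have hbA : ∀ i, Ψ.A (b.map f i) = S.θ i • b.map f i := fun i => by
    simp [← hA, LinearEquiv.conjAlgEquiv_apply, hc.A_apply]
  have hcA : ∀ i, Ψ.Astar (c.map f i) = S.θs i • c.map f i := fun i => by
    simp [← hAs, LinearEquiv.conjAlgEquiv_apply, hc.Astar_apply]
  refine ⟨b.map f, c.map f, fun j => ?_, hbA, hcA, fun i => ?_, fun i => ?_⟩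
  · simp [hX j]
  · rw [isPrimitiveIdempotent_iff S.west.injective hbA]
    intro x
    simp [← hE, LinearEquiv.conjAlgEquiv_apply,
      (isPrimitiveIdempotent_iff S.west.injective hc.A_apply).1 (hc.E_eq i)]
  · rw [isPrimitiveIdempotent_iff S.south.injective hcA]
    intro x
    simp [← hEs, LinearEquiv.conjAlgEquiv_apply,
      (isPrimitiveIdempotent_iff S.south.injective hc.Astar_apply).1 (hc.Estar_eq i)]

end Correspondence

/-! ### The polynomials `η` and `τ` -/

section Products

variable {K : Type u} [Field K] {d : ℕ}

lemma prod_filter_lt_succ {M : Type*} [CommMonoid M] {n : ℕ} (g : Fin n → M) {h : ℕ} (hh : h < n) :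
    ∏ k ∈ Finset.univ.filter (fun k : Fin n => (k : ℕ) < h + 1), g k =
      (∏ k ∈ Finset.univ.filter (fun k : Fin n => (k : ℕ) < h), g k) * g ⟨h, hh⟩ := by
  have : Finset.univ.filter (fun k : Fin n => (k : ℕ) < h + 1) =
      insert ⟨h, hh⟩ (Finset.univ.filter fun k : Fin n => (k : ℕ) < h) := by
    ext k
    simp only [Finset.mem_filter, Finset.mem_univ, true_and, Finset.mem_insert, Fin.ext_iff]
    omega
  rw [this, Finset.prod_insert (by simp), mul_comm]

lemma eta_zero (θ : Fin (d + 1) → K) : eta θ 0 = 1 := by simp [eta]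

lemma eta_succ (θ : Fin (d + 1) → K) {n : ℕ} (hn : n < d + 1) :
    eta θ (n + 1) = eta θ n * (X - C (θ (Fin.rev ⟨n, hn⟩))) :=
  prod_filter_lt_succ _ hn

lemma monic_eta (θ : Fin (d + 1) → K) (n : ℕ) : (eta θ n).Monic :=
  monic_prod_of_monic _ _ fun _ _ => monic_X_sub_C _

lemma natDegree_eta (θ : Fin (d + 1) → K) {n : ℕ} (hn : n ≤ d + 1) : (eta θ n).natDegree = n := by
  induction n with
  | zero => simp [eta_zero]
  | succ n ih =>
    rw [eta_succ θ hn, (monic_eta θ n).natDegree_mul (monic_X_sub_C _), ih (by omega),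
      natDegree_X_sub_C]

lemma eval_eta_eq_zero (θ : Fin (d + 1) → K) {n : ℕ} {k : Fin (d + 1)} (hk : (Fin.rev k : ℕ) < n) :
    (eta θ n).eval (θ k) = 0 := by
  rw [eta, eval_prod]
  exact Finset.prod_eq_zero (i := Fin.rev k) (by simpa using hk) (by simp)

lemma eval_eta_ne_zero {θ : Fin (d + 1) → K} (hθ : Function.Injective θ) {n : ℕ} (hn : n ≤ d) :
    (eta θ n).eval (θ 0) ≠ 0 := by
  rw [eta, eval_prod]
  refine Finset.prod_ne_zero_iff.2 fun k hk => ?_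
  rw [eval_sub, eval_X, eval_C, sub_ne_zero]
  refine hθ.ne fun h => ?_
  have h1 : (k : ℕ) < n := by simpa using hk
  have h2 := congrArg Fin.val h
  simp only [Fin.val_zero, Fin.val_rev] at h2
  omega

lemma eval_tau_succ (θ : Fin (d + 1) → K) {n : ℕ} (hn : n < d + 1) (y : K) :
    (tau θ (n + 1)).eval y = (tau θ n).eval y * (y - θ ⟨n, hn⟩) := by
  rw [tau, prod_filter_lt_succ _ hn]
  simp [tau]

end Products

/-! ### The split decomposition and the parameter array -/

section Split

variable {K : Type u} [Field K] {d : ℕ} {V : Type w} [AddCommGroup V] [Module K V]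
  {Φ : THSystem K V d} {S : NormalizedWSVandermondeSystem K d}
  {b c : Module.Basis (Fin (d + 1)) K V}

/-- The vectors `η_n(A) v`; for a suitable eigenvector `v` of `A*` they span the split
decomposition. -/
noncomputable def THSystem.splitVector (Φ : THSystem K V d) (θ : Fin (d + 1) → K) (v : V)
    (n : ℕ) : V :=
  aeval Φ.A (eta θ n) v

lemma THSystem.splitVector_succ (Φ : THSystem K V d) (θ : Fin (d + 1) → K) (v : V)
    (k : Fin (d + 1)) :
    Φ.splitVector θ v (k + 1) = (Φ.A - θ (Fin.rev k) • 1) (Φ.splitVector θ v k) := by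
  rw [splitVector, eta_succ θ k.2, mul_comm, map_mul, Module.End.mul_apply, map_sub, aeval_X,
    aeval_C, Algebra.algebraMap_eq_smul_one]
  rfl

namespace THSystem.IsConstructedFrom

lemma mem_splitSpace_iff (h : Φ.IsConstructedFrom S b c) {i : Fin (d + 1)} {x : V} :
    x ∈ Φ.splitSpace i ↔ (∀ k, i < k → c.repr x k = 0) ∧
      ∀ k, Fin.rev i < k → b.repr x k = 0 := by
  have hE := fun j => range_eq_span_of_eigenbasis
    ((isPrimitiveIdempotent_iff S.west.injective h.A_apply).1 (h.E_eq j))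
  have hEs := fun j => range_eq_span_of_eigenbasis
    ((isPrimitiveIdempotent_iff S.south.injective h.Astar_apply).1 (h.Estar_eq j))
  rw [THSystem.splitSpace, Submodule.mem_inf]
  simp only [hE, hEs]
  rw [mem_iSup_span_iff, mem_iSup_span_iff]

lemma repr_splitVector (h : Φ.IsConstructedFrom S b c) (hX : IsTransitionMatrix S.X b c) (n : ℕ)
    (i : Fin (d + 1)) :
    b.repr (Φ.splitVector S.θ (c 0) n) i = (eta S.θ n).eval (S.θ i) := by
  rw [THSystem.splitVector, repr_aeval_of_eigenbasis h.A_apply]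
  have : b.repr (c 0) i = S.X i 0 := by
    rw [← isTransitionMatrix_iff.1 hX, Module.Basis.toMatrix_apply]
  rw [this, S.west_normalized, mul_one]

/-- The vectors `c j` are obtained from `c 0` by applying polynomials of degree `j` in `A`. -/
lemma exists_graded (h : Φ.IsConstructedFrom S b c) (hX : IsTransitionMatrix S.X b c) :
    ∃ f : Fin (d + 1) → K[X], IsGraded f ∧ ∀ j, c j = aeval Φ.A (f j) (c 0) := by
  obtain ⟨f, hf, hXf⟩ := S.west.exists_graded
  refine ⟨f, hf, fun j => b.ext_elem fun i => ?_⟩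
  rw [repr_aeval_of_eigenbasis h.A_apply, ← Module.Basis.toMatrix_apply b,
    ← Module.Basis.toMatrix_apply b, isTransitionMatrix_iff.1 hX, hXf i j, mul_comm]

lemma splitVector_mem (h : Φ.IsConstructedFrom S b c) (hX : IsTransitionMatrix S.X b c)
    (i : Fin (d + 1)) : Φ.splitVector S.θ (c 0) i ∈ Φ.splitSpace i := by
  rw [h.mem_splitSpace_iff]
  constructor
  · obtain ⟨f, hf, hc⟩ := h.exists_graded hX
    obtain ⟨β, hβ, hp⟩ := hf.exists_coord (i + 1) (by omega) (eta S.θ i) (by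
      refine degree_le_natDegree.trans_lt ?_
      rw [natDegree_eta _ (by omega)]
      exact_mod_cast Nat.lt_succ_self _)
    intro k hk
    have : Φ.splitVector S.θ (c 0) i = ∑ j, β j • c j := by
      rw [THSystem.splitVector, hp, map_sum, LinearMap.sum_apply]
      refine Finset.sum_congr rfl fun j _ => ?_
      rw [hc j, ← smul_eq_C_mul, map_smul, LinearMap.smul_apply]
    rw [this, c.repr_sum_self]
    exact hβ k hk
  · intro k hk
    rw [h.repr_splitVector hX]
    refine eval_eta_eq_zero _ ?_
    have := Fin.lt_def.1 hk
    rw [Fin.val_rev] at this ⊢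
    omega

/-- An element of `U_i` is `p(A) c_0` with `deg p ≤ i` and `p` vanishing at the `i` roots of `η_i`,
so `p` is a multiple of `η_i`. -/
lemma splitSpace_eq_span (h : Φ.IsConstructedFrom S b c) (hX : IsTransitionMatrix S.X b c)
    (i : Fin (d + 1)) : Φ.splitSpace i = K ∙ Φ.splitVector S.θ (c 0) i := by
  refine le_antisymm (fun x hx => ?_)
    ((Submodule.span_singleton_le_iff_mem _ _).2 (h.splitVector_mem hX i))
  rw [h.mem_splitSpace_iff] at hx
  obtain ⟨f, hf, hc⟩ := h.exists_graded hX
  let p : K[X] := ∑ k, C (c.repr x k) * f k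
  have hxp : x = aeval Φ.A p (c 0) := by
    conv_lhs => rw [← c.sum_repr x]
    rw [map_sum, LinearMap.sum_apply]
    refine Finset.sum_congr rfl fun j _ => ?_
    rw [← smul_eq_C_mul, map_smul, LinearMap.smul_apply, ← hc j]
  have hpdeg : ∀ m : ℕ, (i : ℕ) < m → p.coeff m = 0 := by
    intro m hm
    rw [finsetSum_coeff]
    refine Finset.sum_eq_zero fun k _ => ?_
    rw [coeff_C_mul]
    by_cases hk : i < k
    · rw [hx.1 k hk, zero_mul]
    · rw [coeff_eq_zero_of_natDegree_lt (p := f k), mul_zero]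
      rw [hf.natDegree]
      have := Fin.le_def.1 (not_lt.1 hk)
      omega
  have hpeval : ∀ k, b.repr x k = p.eval (S.θ k) := by
    intro k
    rw [hxp, repr_aeval_of_eigenbasis h.A_apply, ← Module.Basis.toMatrix_apply b,
      isTransitionMatrix_iff.1 hX, S.west_normalized, mul_one]
  classical
  have hq : p - C (p.coeff i) * eta S.θ i = 0 := by
    have hdeg := natDegree_eta S.θ (n := i) (by omega)
    refine eq_zero_of_degree_lt_of_eval_finset_eq_zero
      ((Finset.univ.filter (Fin.rev i < ·)).image S.θ) ?_ ?_
    · rw [Finset.card_image_of_injective _ S.west.injective]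
      have hcard : (Finset.univ.filter (Fin.rev i < ·)).card = (i : ℕ) := by
        rw [Finset.filter_lt_eq_Ioi, Fin.card_Ioi, Fin.val_rev]
        omega
      rw [hcard, degree_lt_iff_coeff_zero]
      intro m hm
      rw [coeff_sub, coeff_C_mul]
      rcases hm.eq_or_lt with rfl | hm
      · have : (eta S.θ i).coeff i = 1 := by
          have hlead := (monic_eta S.θ i).coeff_natDegree
          rwa [hdeg] at hlead
        rw [this, mul_one, sub_self]
      · rw [hpdeg m hm, coeff_eq_zero_of_natDegree_lt (p := eta S.θ i) (by omega), mul_zero,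
          sub_zero]
    · simp only [Finset.mem_image, Finset.mem_filter, Finset.mem_univ, true_and]
      rintro _ ⟨k, hk, rfl⟩
      rw [eval_sub, ← hpeval, hx.2 k hk, eval_mul, eval_eta_eq_zero, mul_zero, sub_zero]
      have := Fin.lt_def.1 hk
      rw [Fin.val_rev] at this ⊢
      omega
  rw [sub_eq_zero] at hq
  rw [hxp, hq, ← smul_eq_C_mul, map_smul, LinearMap.smul_apply]
  exact Submodule.smul_mem _ _ (Submodule.mem_span_singleton_self _)

lemma splitVector_ne_zero (h : Φ.IsConstructedFrom S b c) (hX : IsTransitionMatrix S.X b c)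
    {n : ℕ} (hn : n ≤ d) : Φ.splitVector S.θ (c 0) n ≠ 0 := by
  intro h0
  refine eval_eta_ne_zero S.west.injective hn ?_
  rw [← h.repr_splitVector hX, h0]
  simp

/-- `A* - θ*_i` maps `U_i` into `U_{i-1}`: it lowers the filtration by the `c j`, and raises the
filtration by the `b j` by at most one step. The image is nonzero, because no eigenvector of `A*`
for `θ*_i` lies in `U_i` if `i > 0`. -/
lemma exists_split_scalar (h : Φ.IsConstructedFrom S b c) (hX : IsTransitionMatrix S.X b c)
    (k : Fin d) : ∃ a : K, a ≠ 0 ∧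
      (Φ.Astar - S.θs k.succ • 1) (Φ.splitVector S.θ (c 0) (k + 1)) =
        a • Φ.splitVector S.θ (c 0) k := by
  have hu := h.splitVector_mem hX k.succ
  rw [Fin.val_succ] at hu
  set x := Φ.splitVector S.θ (c 0) (k + 1) with hxdef
  rw [h.mem_splitSpace_iff] at hu
  have hcrepr : ∀ i, c.repr ((Φ.Astar - S.θs k.succ • 1) x) i =
      (S.θs i - S.θs k.succ) * c.repr x i := by
    intro i
    simp only [LinearMap.sub_apply, LinearMap.smul_apply, Module.End.one_apply, map_sub, map_smul,
      Finsupp.sub_apply, Finsupp.smul_apply, smul_eq_mul]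
    rw [repr_apply_of_eigenbasis h.Astar_apply, sub_mul]
  have hmem : (Φ.Astar - S.θs k.succ • 1) x ∈ Φ.splitSpace k.castSucc := by
    rw [h.mem_splitSpace_iff]
    constructor
    · intro i hi
      rw [hcrepr]
      by_cases hik : i = k.succ
      · rw [hik, sub_self, zero_mul]
      · rw [hu.1 i (lt_of_le_of_ne (Fin.castSucc_lt_iff_succ_le.1 hi) (Ne.symm hik)), mul_zero]
    · intro i hi
      have hi' := Fin.lt_def.1 hi
      rw [Fin.val_rev, Fin.val_castSucc] at hi'
      simp only [LinearMap.sub_apply, LinearMap.smul_apply, Module.End.one_apply, map_sub,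
        map_smul, Finsupp.sub_apply, Finsupp.smul_apply, smul_eq_mul]
      rw [hu.2 i (by rw [Fin.lt_def, Fin.val_rev, Fin.val_succ]; omega), mul_zero, sub_zero,
        repr_apply_eq_sum]
      refine Finset.sum_eq_zero fun j _ => ?_
      by_cases hj : Fin.rev k.succ < j
      · rw [hu.2 j hj, zero_mul]
      · have hj' := Fin.le_def.1 (not_lt.1 hj)
        rw [Fin.val_rev, Fin.val_succ] at hj'
        rw [(mul_mul_eq_zero_iff (T := Φ.Astar) (fun l =>
          (isPrimitiveIdempotent_iff S.west.injective h.A_apply).1 (h.E_eq l)) i j).1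
            (Φ.E_Astar_E_eq_zero i j (by omega)), mul_zero]
  rw [h.splitSpace_eq_span hX, Submodule.mem_span_singleton] at hmem
  obtain ⟨a, ha⟩ := hmem
  refine ⟨a, ?_, ha.symm⟩
  rintro rfl
  rw [zero_smul] at ha
  have hxc : x = c.repr x k.succ • c k.succ := eq_smul_of_repr_eq_zero fun j hj => by
    have := hcrepr j
    rw [← ha, map_zero, Finsupp.zero_apply, eq_comm, mul_eq_zero, sub_eq_zero] at this
    exact this.resolve_left (S.south.injective.ne hj)
  have hlast := congrArg (fun y => b.repr y (Fin.last d)) hxc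
  simp only [map_smul, Finsupp.smul_apply, smul_eq_mul] at hlast
  rw [hu.2 (Fin.last d) (by rw [Fin.lt_def, Fin.val_rev, Fin.val_succ, Fin.val_last]; omega),
    ← Module.Basis.toMatrix_apply b, isTransitionMatrix_iff.1 hX, S.south_normalized,
    mul_one] at hlast
  rw [← hlast, zero_smul] at hxc
  exact h.splitVector_ne_zero hX (by omega) hxc

/-- The vector `∑_h τ*_h(y) / (φ_1 ⋯ φ_h) η_h(A) c_0`, truncated at `h = n`, is an eigenvector of
`A*` for `y` up to a multiple of its last term. -/
lemma Astar_apply_partial_sum (h : Φ.IsConstructedFrom S b c) {φ : Fin d → K}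
    (hφ0 : ∀ k, φ k ≠ 0)
    (hφ : ∀ k : Fin d, (Φ.Astar - S.θs k.succ • 1) (Φ.splitVector S.θ (c 0) (k + 1)) =
      φ k • Φ.splitVector S.θ (c 0) k) (y : K) (n : ℕ) (hn : n < d + 1) :
    (Φ.Astar - y • 1) (∑ m ∈ Finset.range (n + 1), ((tau S.θs m).eval y /
        ∏ k ∈ Finset.univ.filter (fun k : Fin d => (k : ℕ) < m), φ k) •
          Φ.splitVector S.θ (c 0) m) =
      -(((y - S.θs ⟨n, hn⟩) * ((tau S.θs n).eval y /
        ∏ k ∈ Finset.univ.filter (fun k : Fin d => (k : ℕ) < n), φ k)) •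
          Φ.splitVector S.θ (c 0) n) := by
  induction n with
  | zero =>
    have h0 : (⟨0, hn⟩ : Fin (d + 1)) = 0 := rfl
    simp only [zero_add, Finset.range_one, Finset.sum_singleton, map_smul, h0]
    have : Φ.splitVector S.θ (c 0) 0 = c 0 := by
      simp [THSystem.splitVector, eta_zero]
    rw [this, LinearMap.sub_apply, h.Astar_apply, LinearMap.smul_apply, Module.End.one_apply]
    module
  | succ n ih =>
    have hn' : n < d := by omega
    have hlow := hφ ⟨n, hn'⟩
    rw [LinearMap.sub_apply, LinearMap.smul_apply, Module.End.one_apply, sub_eq_iff_eq_add] at hlow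
    rw [Finset.sum_range_succ, map_add, ih (by omega), map_smul, LinearMap.sub_apply, hlow,
      LinearMap.smul_apply, Module.End.one_apply, eval_tau_succ _ (by omega),
      prod_filter_lt_succ φ hn']
    have hs : (⟨n, hn'⟩ : Fin d).succ = ⟨n + 1, hn⟩ := rfl
    simp only [hs]
    have h1 := hφ0 ⟨n, hn'⟩
    have h2 : ∏ k ∈ Finset.univ.filter (fun k : Fin d => (k : ℕ) < n), φ k ≠ 0 :=
      Finset.prod_ne_zero_iff.2 fun k _ => hφ0 k
    match_scalars
    · field_simp
      ring
    · field_simp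
      ring

/-- The vectors `c j` are the eigenvectors of `A*` in the span of the split vectors that have last
`b`-coordinate one. -/
lemma X_eq_transitionMatrix (h : Φ.IsConstructedFrom S b c) (hX : IsTransitionMatrix S.X b c)
    {φ : Fin d → K} (hφ0 : ∀ k, φ k ≠ 0)
    (hφ : ∀ k : Fin d, (Φ.Astar - S.θs k.succ • 1) (Φ.splitVector S.θ (c 0) (k + 1)) =
      φ k • Φ.splitVector S.θ (c 0) k) : S.X = transitionMatrix S.θ S.θs φ := by
  ext i j
  let t : ℕ → K := fun m => (tau S.θs m).eval (S.θs j) /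
    ∏ k ∈ Finset.univ.filter (fun k : Fin d => (k : ℕ) < m), φ k
  let x : V := ∑ m ∈ Finset.range (d + 1), t m • Φ.splitVector S.θ (c 0) m
  have hrepr : ∀ l, b.repr x l = ∑ m ∈ Finset.range (d + 1), t m * (eta S.θ m).eval (S.θ l) := by
    intro l
    simp only [x, map_sum, map_smul, Finsupp.finsetSum_apply, Finsupp.smul_apply, smul_eq_mul,
      h.repr_splitVector hX]
  have hx0 : (Φ.Astar - S.θs j • 1) x = 0 := by
    refine (h.Astar_apply_partial_sum hφ0 hφ (S.θs j) d (by omega)).trans ?_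
    -- The remaining term vanishes: `τ*_d(y) (y - θ*_d)` has the roots `θ*_0, …, θ*_d`.
    have : (S.θs j - S.θs ⟨d, by omega⟩) * (tau S.θs d).eval (S.θs j) = 0 := by
      rcases (Nat.le_of_lt_succ j.2).eq_or_lt with hj | hj
      · rw [show (⟨d, by omega⟩ : Fin (d + 1)) = j from Fin.ext hj.symm, sub_self, zero_mul]
      · rw [tau, eval_prod, Finset.prod_eq_zero (i := j) (by simpa using hj) (by simp), mul_zero]
    rw [← mul_div_assoc, this, zero_div, zero_smul, neg_zero]
  have hx : x ∈ Φ.Astar.eigenspace (S.θs j) := by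
    rw [Module.End.mem_eigenspace_iff, ← sub_eq_zero]
    exact hx0
  rw [mem_eigenspace_iff_repr h.Astar_apply] at hx
  have hxc : x = c.repr x j • c j :=
    eq_smul_of_repr_eq_zero fun k hk => hx k (S.south.injective.ne hk)
  -- Only the term `m = 0` survives, as `η_m(θ_d) = 0` for `m > 0`.
  have hlast : b.repr x (Fin.last d) = 1 := by
    rw [hrepr, Finset.sum_eq_single_of_mem 0 (by simp)]
    · simp [t, eta_zero, tau]
    · intro m _ hm
      rw [eval_eta_eq_zero, mul_zero]
      rw [Fin.rev_last]
      exact Nat.pos_of_ne_zero hm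
  have hone : c.repr x j = 1 := by
    rw [hxc, map_smul, Finsupp.smul_apply, ← Module.Basis.toMatrix_apply b,
      isTransitionMatrix_iff.1 hX, S.south_normalized, smul_eq_mul, mul_one] at hlast
    exact hlast
  rw [hone, one_smul] at hxc
  rw [← isTransitionMatrix_iff.1 hX, Module.Basis.toMatrix_apply, ← hxc, hrepr,
    ← Fin.sum_univ_eq_sum_range (fun m => t m * (eta S.θ m).eval (S.θ i))]
  simp only [transitionMatrix, twoVar, Matrix.of_apply, t]
  exact Finset.sum_congr rfl fun m _ => by ring

end THSystem.IsConstructedFrom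

lemma Corresponds.exists_parameterArray (h : Corresponds Φ S) :
    ∃ φ, Φ.HasParameterArray S.θ S.θs φ ∧ S.X = transitionMatrix S.θ S.θs φ := by
  obtain ⟨b, c, hX, h⟩ := h
  choose φ hφ0 hφ using h.exists_split_scalar hX
  refine ⟨φ, ⟨⟨h.E_eq, h.Estar_eq⟩, fun k => ?_, fun k x hx => ?_⟩,
    h.X_eq_transitionMatrix hX hφ0 hφ⟩
  · rw [h.splitSpace_eq_span hX, finrank_span_singleton (h.splitVector_ne_zero hX (by omega))]
  · rw [h.splitSpace_eq_span hX, Submodule.mem_span_singleton] at hx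
    obtain ⟨a, rfl⟩ := hx
    have hsucc := Φ.splitVector_succ S.θ (c 0) k.castSucc
    rw [Fin.val_castSucc] at hsucc
    rw [Fin.val_succ, map_smul, hφ, map_smul, map_smul, ← hsucc, smul_comm]

lemma THSystem.HasParameterArray.unique {θ θs θ' θs' : Fin (d + 1) → K} {φ φ' : Fin d → K}
    (h : Φ.HasParameterArray θ θs φ) (h' : Φ.HasParameterArray θ' θs' φ') :
    θ = θ' ∧ θs = θs' ∧ φ = φ' := by
  have h1 : θ = θ' := funext fun i =>
    (h.eigenvalueSequences.1 i).eigenvalue_unique (h'.eigenvalueSequences.1 i)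
  have h2 : θs = θs' := funext fun i =>
    (h.eigenvalueSequences.2 i).eigenvalue_unique (h'.eigenvalueSequences.2 i)
  refine ⟨h1, h2, funext fun k => ?_⟩
  subst h1 h2
  obtain ⟨⟨x, hx⟩, hx0, -⟩ := finrank_eq_one_iff'.1 (h.finrank_splitSpace k)
  have := (h.split k x hx).symm.trans (h'.split k x hx)
  exact smul_left_injective K (fun hx' => hx0 (Subtype.ext hx')) this

lemma Corresponds.eq_of_parameterArray (h : Corresponds Φ S) {θ θs : Fin (d + 1) → K}
    {φ : Fin d → K} (hφ : Φ.HasParameterArray θ θs φ) :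
    S.X = transitionMatrix θ θs φ ∧ S.θ = θ ∧ S.θs = θs := by
  obtain ⟨φ', h1, h2⟩ := h.exists_parameterArray
  obtain ⟨rfl, rfl, rfl⟩ := h1.unique hφ
  exact ⟨h2, rfl, rfl⟩

lemma NormalizedWSVandermondeSystem.ext_of_data {S S' : NormalizedWSVandermondeSystem K d}
    (hX : S.X = S'.X) (hθ : S.θ = S'.θ) (hθs : S.θs = S'.θs) : S = S' := by
  cases S
  cases S'
  simp only at hX hθ hθs
  subst hX hθ hθs
  rfl

lemma Corresponds.unique {S' : NormalizedWSVandermondeSystem K d} (h : Corresponds Φ S)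
    (h' : Corresponds Φ S') : S = S' := by
  obtain ⟨φ, h1, h2⟩ := h.exists_parameterArray
  obtain ⟨h3, h4, h5⟩ := h'.eq_of_parameterArray h1
  exact NormalizedWSVandermondeSystem.ext_of_data (h2.trans h3.symm) h4.symm h5.symm

end Split

/-! ### The maps `ρ` and `χ` on isomorphism classes -/

section Maps

variable {K : Type u} [Field K] {d : ℕ}

lemma isRho_iff {ρ : THIsoClass.{u, v} K d → NormalizedWSVandermondeSystem K d} :
    IsRho.{u, v} ρ ↔ ∀ (V : Type (max u v)) [AddCommGroup V] [Module K V] (Φ : THSystem K V d),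
      Corresponds Φ (ρ (THSystem.isoClass.{u, v} Φ)) := by
  constructor
  · intro h V _ _ Φ
    obtain ⟨S, hS⟩ := Φ.exists_corresponds
    obtain ⟨θ, θs, φ, hφ, h1, h2, h3⟩ := h V Φ
    obtain ⟨k1, k2, k3⟩ := hS.eq_of_parameterArray hφ
    rwa [NormalizedWSVandermondeSystem.ext_of_data (h1.trans k1.symm) (h2.trans k2.symm)
      (h3.trans k3.symm)]
  · intro h V _ _ Φ
    obtain ⟨φ, h1, h2⟩ := (h V Φ).exists_parameterArray
    exact ⟨_, _, φ, h1, h2, rfl, rfl⟩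

lemma isoClass_eq_iff {V W : Type (max u v)} [AddCommGroup V] [Module K V] [AddCommGroup W]
    [Module K W] {Φ : THSystem K V d} {Ψ : THSystem K W d} :
    THSystem.isoClass.{u, v} Φ = THSystem.isoClass.{u, v} Ψ ↔ Φ.Isomorphic Ψ :=
  Quotient.eq

lemma IsChi.isoClass_eq {χ : NormalizedWSVandermondeSystem K d → THIsoClass.{u, v} K d}
    (hχ : IsChi.{u, v} χ) {V : Type (max u v)} [AddCommGroup V] [Module K V] {Φ : THSystem K V d}
    {S : NormalizedWSVandermondeSystem K d} (h : Corresponds Φ S) :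
    χ S = THSystem.isoClass.{u, v} Φ := by
  obtain ⟨b, c, hX, hc⟩ := h
  obtain ⟨Ψ, hΨ, hS⟩ := (hχ S V Φ.finrank_eq).2 b c hX
  rw [hS, isoClass_eq_iff]
  exact Corresponds.isomorphic ⟨b, c, hX, hΨ⟩ ⟨b, c, hX, hc⟩

lemma NormalizedWSVandermondeSystem.exists_corresponds (S : NormalizedWSVandermondeSystem K d) :
    ∃ Φ : THSystem K (ULift.{v} (Fin (d + 1) → K)) d, Corresponds Φ S := by
  have hV : Module.finrank K (ULift.{v} (Fin (d + 1) → K)) = d + 1 := by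
    rw [ULift.moduleEquiv.finrank_eq, Module.finrank_fin_fun]
  obtain ⟨b, c, hX⟩ := S.exists_bases hV
  obtain ⟨Φ, hΦ⟩ := S.exists_isConstructedFrom hV hX
  exact ⟨Φ, b, c, hX, hΦ⟩

lemma exists_isRho (K : Type u) [Field K] (d : ℕ) :
    ∃ ρ : THIsoClass.{u, v} K d → NormalizedWSVandermondeSystem K d, IsRho.{u, v} ρ := by
  choose F hF using fun Φ : THSystemOver.{u, v} K d => Φ.system.exists_corresponds
  exact ⟨Quotient.lift F fun Φ Ψ h => ((hF Φ).of_isomorphic h).unique (hF Ψ),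
    isRho_iff.2 fun V _ _ Φ => hF ⟨V, Φ⟩⟩

lemma exists_isChi (K : Type u) [Field K] (d : ℕ) :
    ∃ χ : NormalizedWSVandermondeSystem K d → THIsoClass.{u, v} K d, IsChi.{u, v} χ := by
  choose F hF using fun S : NormalizedWSVandermondeSystem K d => S.exists_corresponds.{u, v}
  refine ⟨fun S => THSystem.isoClass.{u, v} (F S), fun S V _ _ hV =>
    ⟨S.exists_bases hV, fun b c hX => ?_⟩⟩
  obtain ⟨Φ, hΦ⟩ := S.exists_isConstructedFrom hV hX
  exact ⟨Φ, hΦ, isoClass_eq_iff.2 ((hF S).isomorphic ⟨b, c, hX, hΦ⟩)⟩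

end Maps

end THVand

theorem theorem18p5 (K : Type u) [Field K] (d : ℕ) :
    (∃! ρ : THVand.THIsoClass.{u, v} K d → THVand.NormalizedWSVandermondeSystem K d,
      THVand.IsRho.{u, v} ρ) ∧
    (∃! χ : THVand.NormalizedWSVandermondeSystem K d → THVand.THIsoClass.{u, v} K d,
      THVand.IsChi.{u, v} χ) ∧
    ∀ (ρ : THVand.THIsoClass.{u, v} K d → THVand.NormalizedWSVandermondeSystem K d)
      (χ : THVand.NormalizedWSVandermondeSystem K d → THVand.THIsoClass.{u, v} K d),
      THVand.IsRho.{u, v} ρ → THVand.IsChi.{u, v} χ →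
        ρ ∘ χ = id ∧ χ ∘ ρ = id ∧ Function.Bijective ρ ∧ Function.Bijective χ := by
  refine ⟨?_, ?_, fun ρ χ hρ hχ => ?_⟩
  · obtain ⟨ρ, hρ⟩ := THVand.exists_isRho.{u, v} K d
    refine ⟨ρ, hρ, fun ρ' hρ' => funext fun x => ?_⟩
    obtain ⟨⟨V, Φ⟩, rfl⟩ := Quotient.exists_rep x
    exact (THVand.isRho_iff.1 hρ' V Φ).unique (THVand.isRho_iff.1 hρ V Φ)
  · obtain ⟨χ, hχ⟩ := THVand.exists_isChi.{u, v} K d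
    refine ⟨χ, hχ, fun χ' hχ' => funext fun S => ?_⟩
    obtain ⟨Φ, hΦ⟩ := S.exists_corresponds.{u, v}
    rw [hχ'.isoClass_eq hΦ, hχ.isoClass_eq hΦ]
  · have hl : Function.LeftInverse ρ χ := fun S => by
      obtain ⟨Φ, hΦ⟩ := S.exists_corresponds.{u, v}
      rw [hχ.isoClass_eq hΦ]
      exact (THVand.isRho_iff.1 hρ _ Φ).unique hΦ
    have hr : Function.RightInverse ρ χ := fun x => by
      obtain ⟨⟨V, Φ⟩, rfl⟩ := Quotient.exists_rep x
      exact hχ.isoClass_eq (THVand.isRho_iff.1 hρ V Φ)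
    exact ⟨funext hl, funext hr, ⟨hr.injective, hl.surjective⟩, hl.injective, hr.surjective⟩
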